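/- Consider $n>2$ processes communicating in iterated immediate snapshot (IIS) layers $M[1],\dots,M[r]$. Each layer has one entry per process, initially $\bot$. In round $k$ process $i$, in local state $s$, writes $\mathrm{encode}_i(s,k)$ into $M[k,i]$, takes an immediate snapshot $v$ of $M[k]$, and moves to the state $\mathrm{next}_i(v,s,k)$; its initial state is a function of $i$ and its input. In the full-information IIS protocol the initial state is the input, a process writes its whole state, and its new state is the snapshot. For a chromatic input complex $\mathcal I$ (a simplicial complex with a colouring of its vertices by the $n$ processes under which the vertices of each simplex have distinct colours), the protocol complex after $r$ rounds has as vertices the pairs (process, local state) that are reachable after $r$ rounds, and as simplices the sets of such pairs that occur together in some execution starting from a simplex of $\mathcal I$; it is coloured by processes. Write $\Xi^r(\mathcal I)$ for the protocol complex of the full-information IIS protocol and $\Xi_b^r(\mathcal I)$ for that of the protocol with given initial-state, encoding and next-state functions (bounded IIS). There is an absolute constant $C>0$ such that the following holds for all $n>2$, all $r\ge 1$, all $D\in\mathbb N$ and every chromatic input complex $\mathcal I$ for $n$ processes in which every vertex lies in at most $D$ simplices (every finite $\mathcal I$ has such a $D$). There exist initial-state, encoding and next-state functions such that $$\Xi^r(\mathcal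 I)\cong\Xi_b^r(\mathcal I)$$ as chromatic complexes (by a colour-preserving simplicial isomorphism), and such that every memory entry, whose possible contents are $\bot$ and the values of $\mathrm{encode}_i(\cdot,k)$, $1\le k\le r$, can be stored in at most $$C\,(r\,n\log n+\log D)$$ bits (with the convention $\log 0=0$). In particular, for fixed $D$ the bit complexity is $O(rn\log n)$, with a constant that depends on the input complex only through $D$. -/

import Mathlib

universe u v w

/-- A chromatic simplicial complex for `n` processes: the vertices of each face carry pairwise
distinct colours (process identifiers).  The vertices of the complex are the `x : V` for which
`{x}` is a face.  (Faces are nonempty finite sets.) -/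
structure ChromaticComplex (n : ℕ) (V : Type u) extends PreAbstractSimplicialComplex V where
  color : V → Fin n
  color_injOn : ∀ σ ∈ faces, Set.InjOn color (σ : Set V)

namespace ChromaticComplex

variable {n : ℕ}

/-- The vertices of a chromatic complex. -/
def Vertex {V : Type u} (A : ChromaticComplex n V) : Type u :=
  {x : V // ({x} : Finset V) ∈ A.faces}

/-- The set of points of `V` underlying a finite set of vertices. -/
def points {V : Type u} (A : ChromaticComplex n V) (s : Finset A.Vertex) : Finset V :=
  s.map (Function.Embedding.subtype _)

/-- Isomorphism of chromatic complexes: a colour-preserving bijection between the vertices under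
which faces correspond to faces, in both directions. -/
def Isomorphic {V : Type u} {W : Type v} (A : ChromaticComplex n V) (B : ChromaticComplex n W) :
    Prop :=
  ∃ f : A.Vertex ≃ B.Vertex,
    (∀ x : A.Vertex, B.color (f x).1 = A.color x.1) ∧
    ∀ s : Finset A.Vertex, A.points s ∈ A.faces ↔ B.points (s.map f.toEmbedding) ∈ B.faces

end ChromaticComplex

/-- An iterated immediate snapshot protocol for `n` processes with inputs in `V`, given by the
encoding functions and the next-state functions.  Process `i` runs

    s ← init i (input)
    for k = 1, …, r:
      M[k, i] ← encode i s k
      view ← snapshot (M[k])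
      s ← next i view s k

A snapshot of layer `M[k]` has type `Fin n → Option Msg`, where `none` stands for the initial
value `⊥` of an entry. -/
structure IteratedProtocol (n : ℕ) (V : Type u) where
  State : Type v
  Msg : Type w
  init : Fin n → V → State
  encode : Fin n → State → ℕ → Msg
  next : Fin n → (Fin n → Option Msg) → State → ℕ → State

namespace IteratedProtocol

variable {n : ℕ} {V : Type u}

open Classical in
/-- The result of the snapshot of process `i` in round `k`, started in the configuration `σ`
(a set of pairs `(process, state)`, one for each participating process).  The immediate-snapshot
schedule is an ordered partition of the participating processes into concurrency classes; `block j`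
is the position of the class of `j`.  The processes of a class first write together and then take
their snapshots together, so that `i` sees exactly the entries written by the participating
processes `j` with `block j ≤ block i`. -/
noncomputable def snapshot (P : IteratedProtocol.{u, v, w} n V) (k : ℕ)
    (σ : Finset (Fin n × P.State)) (block : Fin n → ℕ) (i : Fin n) : Fin n → Option P.Msg :=
  fun j => if h : ∃ s, (j, s) ∈ σ ∧ block j ≤ block i then some (P.encode j h.choose k) else none

open Classical in
/-- The configuration reached from `σ` by round `k` under the schedule `block`. -/
noncomputable def runRound (P : IteratedProtocol.{u, v, w} n V) (k : ℕ)
    (σ : Finset (Fin n × P.State)) (block : Fin n → ℕ) : Finset (Fin n × P.State) :=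
  σ.image fun x => (x.1, P.next x.1 (P.snapshot k σ block x.1) x.2 k)

/-- The protocol map of round `k`: the faces of the resulting complex are the configurations of
(the surviving processes of) the executions of round `k` from the faces of `A`. -/
noncomputable def roundMap (P : IteratedProtocol.{u, v, w} n V) (k : ℕ)
    (A : ChromaticComplex n (Fin n × P.State)) (hA : A.color = Prod.fst) :
    ChromaticComplex n (Fin n × P.State) where
  faces := {τ | τ.Nonempty ∧ ∃ σ ∈ A.faces, ∃ block : Fin n → ℕ, τ ⊆ P.runRound k σ block}
  isRelLowerSet_faces := by
    rintro τ ⟨hτ, σ, hσ, block, hsub⟩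
    exact ⟨hτ, fun ρ hρ hne => ⟨hne, σ, hσ, block, hρ.trans hsub⟩⟩
  color := Prod.fst
  color_injOn := by
    classical
    rintro τ ⟨-, σ, hσ, block, hsub⟩ x hx y hy hxy
    obtain ⟨x', hx', rfl⟩ := Finset.mem_image.mp (hsub hx)
    obtain ⟨y', hy', rfl⟩ := Finset.mem_image.mp (hsub hy)
    have h : x' = y' := A.color_injOn σ hσ hx' hy' (by rw [hA]; exact hxy)
    rw [h]

open Classical in
/-- The complex of initial configurations: each vertex `x` of the input complex is replaced by the
process `color x` in its initial state on input `x`. -/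
noncomputable def initialComplex (P : IteratedProtocol.{u, v, w} n V) (I : ChromaticComplex n V) :
    ChromaticComplex n (Fin n × P.State) where
  toPreAbstractSimplicialComplex :=
    I.toPreAbstractSimplicialComplex.map fun x => (I.color x, P.init (I.color x) x)
  color := Prod.fst
  color_injOn := by
    rintro τ ⟨σ, hσ, rfl⟩ x hx y hy hxy
    obtain ⟨x', hx', rfl⟩ := Finset.mem_image.mp hx
    obtain ⟨y', hy', rfl⟩ := Finset.mem_image.mp hy
    have h : x' = y' := I.color_injOn σ hσ hx' hy' hxy
    rw [h]

/-- The complex of configurations after `k` rounds, together with the fact that a vertex is coloured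
by its process. -/
noncomputable def complexAux (P : IteratedProtocol.{u, v, w} n V) (I : ChromaticComplex n V) :
    ℕ → {A : ChromaticComplex n (Fin n × P.State) // A.color = Prod.fst}
  | 0 => ⟨P.initialComplex I, rfl⟩
  | k + 1 => ⟨P.roundMap (k + 1) (P.complexAux I k).1 (P.complexAux I k).2, rfl⟩

/-- The protocol complex of `P` on the input complex `I` after `r` rounds. -/
noncomputable def protocolComplex (P : IteratedProtocol.{u, v, w} n V) (r : ℕ)
    (I : ChromaticComplex n V) : ChromaticComplex n (Fin n × P.State) :=
  (P.complexAux I r).1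

/-- The encoding set of process `i`: the values that its encoding function takes in rounds
`1, …, r`. -/
def encodingSet (P : IteratedProtocol.{u, v, w} n V) (r : ℕ) (i : Fin n) : Set P.Msg :=
  {m | ∃ (s : P.State) (k : ℕ), 1 ≤ k ∧ k ≤ r ∧ P.encode i s k = m}

/-- `b` bits per memory entry suffice for `r` rounds: the possible contents of an entry of process
`i`, namely `⊥` and the values in its encoding set, are representable by distinct strings of `b`
bits. -/
def FitsInBits (P : IteratedProtocol.{u, v, w} n V) (r b : ℕ) : Prop :=
  ∀ i : Fin n, Nonempty (Option (P.encodingSet r i) ↪ (Fin b → Bool))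

end IteratedProtocol

/-- The local states of the full-information protocol: an input, or a snapshot of local states. -/
inductive FullState (n : ℕ) (V : Type u) : Type u
  | input (x : V) : FullState n V
  | view (M : Fin n → Option (FullState n V)) : FullState n V

/-- The full-information iterated immediate snapshot protocol: a process writes its whole state and
takes the snapshot that it obtains as its new state. -/
def fullInformation (n : ℕ) (V : Type u) : IteratedProtocol.{u, u, u} n V where
  State := FullState n V
  Msg := FullState n V
  init := fun _ x => FullState.input x
  encode := fun _ s _ => s
  next := fun _ M _ _ => FullState.view M

/-!
The bounded protocol keeps the local states of the full-information protocol and only compresses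
what is written.  A process that is in state `s` and reads an entry of process `j` knows that the
writer occupies a vertex adjacent to its own one.  It therefore recovers the state of `j` from any
colouring of the vertices that takes distinct values on any two vertices with a common neighbour.
With such a colouring for each round, the next state can be taken to be the decoded snapshot, and
the two protocol complexes are then equal (`complexAux_compressed`).

The number of colours is controlled by the number of simplices at a vertex.  If each vertex lies in
at most `D` simplices, it shares a neighbour with at most `D ^ 2` vertices, and a greedy colouring
along a well-order needs at most `D ^ 2 + 1` colours, even for an infinite complex
(`FaceDegreeLE.exists_locallySeparating`).  A round multiplies the bound `D` by at most `n ^ n * 2 ^ n`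
(`FaceDegreeLE.roundMap`): a full-information state determines the previous state of its owner, the
schedule matters only through an `n`-tuple of ranks below `n`, and a configuration has at most
`2 ^ n` subsets.  So `(D * (n ^ n * 2 ^ n) ^ r) ^ 2 + 1` colours suffice for `r` rounds, and the
logarithm of this number is `O(r n log n + log D)` (`exists_bit_bound`).
-/

/-! ### Greedy colouring of relations of bounded degree -/

/-- A symmetric relation in which every element has at most `N` relatives, on a set of arbitrary
cardinality, can be properly coloured with `N + 1` colours: colour greedily along a well-order. -/
theorem exists_greedy_coloring {α : Type u} (R : α → α → Prop) (hR : ∀ x y, R x y → R y x) (N : ℕ)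
    (hN : ∀ x, ∃ F : Finset α, F.card ≤ N ∧ ∀ y, R x y → y ∈ F) :
    ∃ c : α → ℕ, (∀ x, c x < N + 1) ∧ ∀ x y, x ≠ y → R x y → c x ≠ c y := by
  classical
  choose F hFcard hF using hN
  have hfree : ∀ T : Finset ℕ, ∃ m, T.card ≤ N → m < N + 1 ∧ m ∉ T := by
    intro T
    by_cases hT : T.card ≤ N
    · obtain ⟨m, hm, hmT⟩ := Finset.exists_mem_notMem_of_card_lt_card
        (s := T) (t := Finset.range (N + 1)) (by rw [Finset.card_range]; omega)
      exact ⟨m, fun _ => ⟨Finset.mem_range.mp hm, hmT⟩⟩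
    · exact ⟨0, fun h => absurd h hT⟩
  choose f hf using hfree
  -- The colours already used on the relatives of `x` that precede `x`; the others contribute `0`,
  -- which does not affect the cardinality bound.
  let used : (x : α) → ((y : α) → WellOrderingRel y x → ℕ) → Finset ℕ := fun x ih =>
    (F x).image fun y => if h : WellOrderingRel y x then ih y h else 0
  have wf : WellFounded (WellOrderingRel : α → α → Prop) := WellOrderingRel.isWellOrder.wf
  let c : α → ℕ := wf.fix fun x ih => f (used x ih)
  have hc : ∀ x, c x = f (used x fun y _ => c y) := fun x => wf.fix_eq _ x
  have hspec : ∀ x, c x < N + 1 ∧ c x ∉ used x fun y _ => c y := by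
    intro x
    rw [hc x]
    exact hf _ (Finset.card_image_le.trans (hFcard x))
  have hlt : ∀ x y, WellOrderingRel y x → R x y → c x ≠ c y := by
    intro x y hyx hxy heq
    refine (hspec x).2 (Finset.mem_image.mpr ⟨y, hF x y hxy, ?_⟩)
    rw [dif_pos hyx, heq]
  refine ⟨c, fun x => (hspec x).1, fun x y hne hxy => ?_⟩
  rcases trichotomous_of WellOrderingRel x y with h | h | h
  · exact (hlt y x h (hR x y hxy)).symm
  · exact absurd h hne
  · exact hlt x y h hxy

/-! ### Complexes of bounded degree and their colourings -/

namespace ChromaticComplex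

variable {n : ℕ} {V : Type u}

/-- Two points are adjacent if some face contains both; in particular every vertex is adjacent to
itself. -/
def Adjacent (A : ChromaticComplex n V) (x y : V) : Prop :=
  ∃ σ ∈ A.faces, x ∈ σ ∧ y ∈ σ

/-- Every point lies in at most `D` faces, expressed by a finite set that contains these faces. -/
def FaceDegreeLE (A : ChromaticComplex n V) (D : ℕ) : Prop :=
  ∀ x, ∃ F : Finset (Finset V), F.card ≤ D ∧ ∀ σ ∈ A.faces, x ∈ σ → σ ∈ F

/-- A function on the points is locally separating if it is injective on the closed neighbourhood
of every point. -/
def LocallySeparating (A : ChromaticComplex n V) (c : V → ℕ) : Prop :=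
  ∀ z x y, A.Adjacent z x → A.Adjacent z y → c x = c y → x = y

theorem Adjacent.symm {A : ChromaticComplex n V} {x y : V} (h : A.Adjacent x y) :
    A.Adjacent y x := by
  obtain ⟨σ, hσ, hx, hy⟩ := h
  exact ⟨σ, hσ, hy, hx⟩

theorem faceDegreeLE_of_encard_le {A : ChromaticComplex n V} {D : ℕ}
    (h : ∀ x, {σ | σ ∈ A.faces ∧ x ∈ σ}.encard ≤ (D : ℕ∞)) : A.FaceDegreeLE D := by
  intro x
  have hfin := Set.finite_of_encard_le_coe (h x)
  refine ⟨hfin.toFinset, ?_, fun σ hσ hx => hfin.mem_toFinset.mpr ⟨hσ, hx⟩⟩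
  have := h x
  rw [hfin.encard_eq_coe_toFinset_card] at this
  exact_mod_cast this

/-- A point `x` has at most as many neighbours `y` as there are faces at `x`: the faces `{x, y}` are
distinct. -/
theorem FaceDegreeLE.exists_neighbours {A : ChromaticComplex n V} {D : ℕ} (h : A.FaceDegreeLE D)
    (x : V) : ∃ F : Finset V, F.card ≤ D ∧ ∀ y, A.Adjacent x y → y ∈ F := by
  classical
  obtain ⟨F, hF, hmem⟩ := h x
  have hedge : ∀ y, A.Adjacent x y → ({x, y} : Finset V) ∈ F := by
    rintro y ⟨σ, hσ, hx, hy⟩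
    refine hmem _ ((A.isRelLowerSet_faces hσ).2 ?_ ⟨x, by simp⟩) (by simp)
    intro z hz
    rcases Finset.mem_insert.mp hz with rfl | hz
    · exact hx
    · rwa [Finset.mem_singleton.mp hz]
  have hinj : Function.Injective fun y => ({x, y} : Finset V) := by
    intro y z hyz
    have h1 : y ∈ ({x, z} : Finset V) := by rw [← show ({x, y} : Finset V) = {x, z} from hyz]; simp
    have h2 : z ∈ ({x, y} : Finset V) := by rw [show ({x, y} : Finset V) = {x, z} from hyz]; simp
    simp only [Finset.mem_insert, Finset.mem_singleton] at h1 h2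
    grind
  refine ⟨F.preimage _ hinj.injOn, ?_, fun y hy => Finset.mem_preimage.mpr (hedge y hy)⟩
  rw [← Finset.card_image_of_injective _ hinj]
  exact (Finset.card_le_card
    (Finset.image_subset_iff.mpr fun y hy => Finset.mem_preimage.mp hy)).trans hF

theorem FaceDegreeLE.exists_locallySeparating {A : ChromaticComplex n V} {D : ℕ}
    (h : A.FaceDegreeLE D) : ∃ c : V → ℕ, (∀ x, c x < D ^ 2 + 1) ∧ A.LocallySeparating c := by
  classical
  choose N hN hmem using h.exists_neighbours
  have hcard : ∀ x, ((N x).biUnion N).card ≤ D ^ 2 := fun x =>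
    calc ((N x).biUnion N).card ≤ (N x).card * D :=
          Finset.card_biUnion_le_card_mul _ _ _ fun z _ => hN z
      _ ≤ D ^ 2 := by rw [sq]; exact Nat.mul_le_mul_right _ (hN x)
  obtain ⟨c, hc, hsep⟩ := exists_greedy_coloring
    (fun x y => ∃ z, A.Adjacent z x ∧ A.Adjacent z y)
    (fun x y ⟨z, hx, hy⟩ => ⟨z, hy, hx⟩) (D ^ 2) fun x => ⟨(N x).biUnion N, hcard x,
      fun y ⟨z, hx, hy⟩ => Finset.mem_biUnion.mpr ⟨z, hmem x z hx.symm, hmem z y hy⟩⟩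
  refine ⟨c, hc, fun z x y hx hy hxy => ?_⟩
  by_contra hne
  exact hsep x y hne ⟨z, hx, hy⟩ hxy

theorem card_le_of_mem_faces (A : ChromaticComplex n V) {σ : Finset V} (hσ : σ ∈ A.faces) :
    σ.card ≤ n := by
  simpa using Finset.card_le_card_of_injOn (t := Finset.univ) A.color (fun _ _ => Finset.mem_univ _)
    (A.color_injOn σ hσ)

theorem Isomorphic.refl (A : ChromaticComplex n V) : A.Isomorphic A :=
  ⟨Equiv.refl _, fun _ => rfl, fun s => by
    rw [show (Equiv.refl A.Vertex).toEmbedding = Function.Embedding.refl _ from rfl,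
      Finset.map_refl]⟩

end ChromaticComplex

/-! ### Degrees in the full-information protocol complex -/

/-- A schedule can be replaced by a tuple of ranks below `n` that orders the processes in the same
way. -/
theorem exists_rank {n : ℕ} (block : Fin n → ℕ) :
    ∃ rank : Fin n → Fin n, ∀ i j, (rank i : ℕ) ≤ rank j ↔ block i ≤ block j := by
  have hlt : ∀ i, (Finset.univ.filter fun j => block j < block i).card < n := by
    intro i
    have := Finset.card_lt_univ_of_notMem
      (s := Finset.univ.filter fun j => block j < block i) (x := i) (by simp)
    simpa using this
  refine ⟨fun i => ⟨_, hlt i⟩, fun i j => ⟨fun h => ?_, fun h => ?_⟩⟩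
  · by_contra! hji
    refine absurd h (not_le.mpr ?_)
    refine Finset.card_lt_card (s := Finset.univ.filter fun l => block l < block j)
      (t := Finset.univ.filter fun l => block l < block i) ?_
    refine (Finset.ssubset_iff_of_subset fun l hl => ?_).mpr ⟨j, by simpa using hji, by simp⟩
    simp only [Finset.mem_filter_univ] at hl ⊢
    omega
  · refine Finset.card_le_card (s := Finset.univ.filter fun l => block l < block i)
      (t := Finset.univ.filter fun l => block l < block j) fun l hl => ?_
    simp only [Finset.mem_filter_univ] at hl ⊢
    omega

namespace IteratedProtocol

variable {n : ℕ} {V : Type u}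

theorem runRound_congr (P : IteratedProtocol.{u, v, w} n V) (k : ℕ) (σ : Finset (Fin n × P.State))
    {block block' : Fin n → ℕ} (h : ∀ i j, block i ≤ block j ↔ block' i ≤ block' j) :
    P.runRound k σ block = P.runRound k σ block' := by
  have : P.snapshot k σ block = P.snapshot k σ block' := by
    funext i j
    have hij : (block j ≤ block i) = (block' j ≤ block' i) := propext (h j i)
    dsimp only [snapshot]
    rw [hij]
  simp only [runRound, this]

theorem card_runRound_le (P : IteratedProtocol.{u, v, w} n V) (k : ℕ)
    (σ : Finset (Fin n × P.State)) (block : Fin n → ℕ) :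
    (P.runRound k σ block).card ≤ σ.card := by
  classical
  exact Finset.card_image_le

end IteratedProtocol

namespace ChromaticComplex

variable {n : ℕ} {V : Type u}

theorem FaceDegreeLE.initialComplex {I : ChromaticComplex n V} {D : ℕ} (h : I.FaceDegreeLE D) :
    ((fullInformation n V).initialComplex I).FaceDegreeLE D := by
  classical
  rintro ⟨i, s⟩
  cases s with
  | input x =>
    obtain ⟨F, hF, hmem⟩ := h x
    refine ⟨F.image fun σ => σ.image fun y => (I.color y, FullState.input y),
      Finset.card_image_le.trans hF, ?_⟩
    rintro τ ⟨σ, hσ, rfl⟩ hx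
    obtain ⟨y, hy, hyx⟩ := Finset.mem_image.mp hx
    obtain rfl : y = x := FullState.input.inj (Prod.mk.inj hyx).2
    exact Finset.mem_image.mpr ⟨σ, hmem σ hσ hy, by congr!⟩
  | view M =>
    refine ⟨∅, by simp, ?_⟩
    rintro τ ⟨σ, hσ, rfl⟩ hx
    obtain ⟨y, hy, hyx⟩ := Finset.mem_image.mp hx
    exact absurd (Prod.mk.inj hyx).2 (by simp [fullInformation])

/-- A process of a configuration finds its own state in its snapshot. -/
theorem snapshot_self {A : ChromaticComplex n (Fin n × FullState n V)} (hA : A.color = Prod.fst)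
    {σ : Finset (Fin n × FullState n V)} (hσ : σ ∈ A.faces) (k : ℕ) (block : Fin n → ℕ)
    {i : Fin n} {s : FullState n V} (hs : (i, s) ∈ σ) :
    (fullInformation n V).snapshot k σ block i i = some s := by
  have hex : ∃ t, (i, t) ∈ σ ∧ block i ≤ block i := ⟨s, hs, le_rfl⟩
  have hch : hex.choose = s := by
    have := A.color_injOn σ hσ hex.choose_spec.1 hs (by rw [hA])
    exact (Prod.mk.inj this).2
  exact (dif_pos hex).trans (congrArg some hch)

/-- One round of the full-information protocol multiplies the number of faces at a vertex by at most
`n ^ n * 2 ^ n`: the state of a process determines its previous state, and a face is given by a face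
at the previous vertex, a tuple of ranks and a set of surviving processes. -/
theorem FaceDegreeLE.roundMap {A : ChromaticComplex n (Fin n × FullState n V)} {D : ℕ}
    (h : A.FaceDegreeLE D) (hA : A.color = Prod.fst) (k : ℕ) :
    ((fullInformation n V).roundMap k A hA).FaceDegreeLE (D * (n ^ n * 2 ^ n)) := by
  classical
  rintro ⟨i, w⟩
  by_cases hw : ∃ M s, w = FullState.view M ∧ M i = some s
  · obtain ⟨M, s, rfl, hM⟩ := hw
    obtain ⟨F, hF, hmem⟩ := h (i, s)
    refine ⟨((F.filter (· ∈ A.faces)) ×ˢ (Finset.univ : Finset (Fin n → Fin n))).biUnion fun p =>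
      ((fullInformation n V).runRound k p.1 fun j => p.2 j).powerset, ?_, ?_⟩
    · refine (Finset.card_biUnion_le_card_mul _ _ (2 ^ n) fun p hp => ?_).trans ?_
      · rw [Finset.card_powerset]
        refine Nat.pow_le_pow_right two_pos ((IteratedProtocol.card_runRound_le _ _ _ _).trans ?_)
        exact A.card_le_of_mem_faces (Finset.mem_filter.mp (Finset.mem_product.mp hp).1).2
      · rw [Finset.card_product, Finset.card_univ, Fintype.card_fun, Fintype.card_fin, mul_assoc]
        exact Nat.mul_le_mul_right _ ((Finset.card_filter_le _ _).trans hF)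
    · rintro τ ⟨-, σ, hσ, block, hsub⟩ hx
      obtain ⟨⟨j, t⟩, hjt, heq⟩ := Finset.mem_image.mp (hsub hx)
      obtain ⟨hji, hview⟩ := Prod.mk.inj heq
      obtain rfl : j = i := hji
      have hsnap := congrFun (FullState.view.inj hview) j
      rw [snapshot_self hA hσ k block hjt, hM] at hsnap
      obtain rfl : t = s := Option.some.inj hsnap
      obtain ⟨rank, hrank⟩ := exists_rank block
      refine Finset.mem_biUnion.mpr ⟨(σ, rank), ?_, Finset.mem_powerset.mpr ?_⟩
      · exact Finset.mem_product.mpr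
          ⟨Finset.mem_filter.mpr ⟨hmem σ hσ hjt, hσ⟩, Finset.mem_univ _⟩
      · rwa [IteratedProtocol.runRound_congr _ k σ hrank]
  · refine ⟨∅, by simp, ?_⟩
    rintro τ ⟨-, σ, hσ, block, hsub⟩ hx
    obtain ⟨⟨j, t⟩, hjt, heq⟩ := Finset.mem_image.mp (hsub hx)
    obtain ⟨hji, hview⟩ := Prod.mk.inj heq
    obtain rfl : j = i := hji
    exact absurd ⟨_, t, hview.symm, snapshot_self hA hσ k block hjt⟩ hw

theorem FaceDegreeLE.complexAux {I : ChromaticComplex n V} {D : ℕ} (h : I.FaceDegreeLE D) (k : ℕ) :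
    ((fullInformation n V).complexAux I k).1.FaceDegreeLE (D * (n ^ n * 2 ^ n) ^ k) := by
  induction k with
  | zero =>
    rw [pow_zero, mul_one]
    exact h.initialComplex
  | succ k ih =>
    rw [pow_succ, ← mul_assoc]
    exact ih.roundMap ((fullInformation n V).complexAux I k).2 (k + 1)

end ChromaticComplex

/-! ### The compressed protocol -/

open Classical in
/-- The full-information protocol with compressed entries.  The colouring `c k` of the complex `A k`
of configurations after `k` rounds is what a process writes in round `k + 1`.  A process in state
`s` replaces each number in its snapshot by the state of an adjacent vertex with that colour; the
default value `s` is never used for a locally separating colouring and a genuine snapshot. -/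
noncomputable def compressedProtocol {n : ℕ} {V : Type u}
    (A : ℕ → ChromaticComplex n (Fin n × FullState n V)) (c : ℕ → Fin n × FullState n V → ℕ) :
    IteratedProtocol.{u, u, 0} n V where
  State := FullState n V
  Msg := ℕ
  init := fun _ x => FullState.input x
  encode := fun i s k => c (k - 1) (i, s)
  next := fun i M s k => FullState.view fun j => (M j).map fun m =>
    if h : ∃ t, (A (k - 1)).Adjacent (i, s) (j, t) ∧ c (k - 1) (j, t) = m then h.choose else s

namespace IteratedProtocol

variable {n : ℕ} {V : Type u}

theorem runRound_compressed {A : ℕ → ChromaticComplex n (Fin n × FullState n V)}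
    {c : ℕ → Fin n × FullState n V → ℕ} {k : ℕ} (hsep : (A k).LocallySeparating (c k))
    {σ : Finset (Fin n × FullState n V)} (hσ : σ ∈ (A k).faces) (block : Fin n → ℕ) :
    (compressedProtocol A c).runRound (k + 1) σ block =
      (fullInformation n V).runRound (k + 1) σ block := by
  classical
  refine Finset.image_congr ?_
  rintro ⟨i, s⟩ hs
  refine Prod.ext rfl (congrArg FullState.view (funext fun j => ?_))
  by_cases hex : ∃ t, (j, t) ∈ σ ∧ block j ≤ block i
  · have hcomp : (compressedProtocol A c).snapshot (k + 1) σ block i j =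
        some (c k (j, hex.choose)) := dif_pos hex
    have hfull : (fullInformation n V).snapshot (k + 1) σ block i j = some hex.choose :=
      dif_pos hex
    have hadj : (A k).Adjacent (i, s) (j, hex.choose) := ⟨σ, hσ, hs, hex.choose_spec.1⟩
    have hdec : ∃ t, (A k).Adjacent (i, s) (j, t) ∧ c k (j, t) = c k (j, hex.choose) :=
      ⟨_, hadj, rfl⟩
    have heq : hdec.choose = hex.choose :=
      (Prod.mk.inj (hsep _ _ _ hdec.choose_spec.1 hadj hdec.choose_spec.2)).2
    refine (congrArg _ hcomp).trans (Eq.trans ?_ hfull.symm)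
    exact congrArg some ((dif_pos hdec).trans heq)
  · have hcomp : (compressedProtocol A c).snapshot (k + 1) σ block i j = none := dif_neg hex
    have hfull : (fullInformation n V).snapshot (k + 1) σ block i j = none := dif_neg hex
    exact (congrArg _ hcomp).trans hfull.symm

/-- With locally separating colourings, the compressed protocol passes through the same complexes of
configurations as the full-information protocol. -/
theorem complexAux_compressed (I : ChromaticComplex n V) {c : ℕ → Fin n × FullState n V → ℕ}
    (hsep : ∀ k, ((fullInformation n V).complexAux I k).1.LocallySeparating (c k)) (k : ℕ) :
    (compressedProtocol (fun k => ((fullInformation n V).complexAux I k).1) c).complexAux I k =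
      (fullInformation n V).complexAux I k := by
  induction k with
  | zero => rfl
  | succ k ih =>
    refine Subtype.ext ?_
    -- The pair of complex and colour proof is generalized to `B`, since `roundMap` depends on both.
    have hround : ∀ (B : {B : ChromaticComplex n (Fin n × FullState n V) // B.color = Prod.fst}),
        B = (fullInformation n V).complexAux I k →
        (compressedProtocol (fun k => ((fullInformation n V).complexAux I k).1) c).roundMap
          (k + 1) B.1 B.2 = (fullInformation n V).roundMap (k + 1)
            ((fullInformation n V).complexAux I k).1 ((fullInformation n V).complexAux I k).2 := by
      rintro B rfl
      have hfaces : ((compressedProtocol (fun k => ((fullInformation n V).complexAux I k).1)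
          c).roundMap (k + 1) ((fullInformation n V).complexAux I k).1
            ((fullInformation n V).complexAux I k).2).toPreAbstractSimplicialComplex =
          ((fullInformation n V).roundMap (k + 1) ((fullInformation n V).complexAux I k).1
            ((fullInformation n V).complexAux I k).2).toPreAbstractSimplicialComplex := by
        refine PreAbstractSimplicialComplex.ext (Set.ext fun τ => and_congr_right fun _ => ?_)
        refine exists_congr fun σ => and_congr_right fun hσ => exists_congr fun block => ?_
        rw [← runRound_compressed (A := fun k => ((fullInformation n V).complexAux I k).1)
          (hsep k) hσ block]
        rfl
      unfold roundMap at hfaces ⊢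
      congr 1
    exact hround _ ih

theorem fitsInBits_compressed (A : ℕ → ChromaticComplex n (Fin n × FullState n V))
    {c : ℕ → Fin n × FullState n V → ℕ} {r b N : ℕ} (hc : ∀ k < r, ∀ x, c k x < N)
    (hN : N + 1 ≤ 2 ^ b) : (compressedProtocol A c).FitsInBits r b := by
  intro i
  have hlt : ∀ m : (compressedProtocol A c).encodingSet r i, (show ℕ from m.1) < N := by
    rintro ⟨m, s, k, hk, hkr, rfl⟩
    exact hc (k - 1) (by omega) (i, s)
  let e : (compressedProtocol A c).encodingSet r i ↪ Fin N :=
    ⟨fun m => ⟨_, hlt m⟩, fun m m' h => Subtype.ext (Fin.mk.inj h)⟩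
  have hcard : Fintype.card (Option (Fin N)) ≤ Fintype.card (Fin b → Bool) := by
    simpa using hN
  obtain ⟨g⟩ := Function.Embedding.nonempty_of_card_le hcard
  exact ⟨e.optionMap.trans g⟩

end IteratedProtocol

/-! ### The number of bits -/

theorem exists_bit_bound {n : ℕ} (hn : 2 < n) (D : ℕ) {r : ℕ} (hr : 1 ≤ r) :
    ∃ b : ℕ, (D * (n ^ n * 2 ^ n) ^ r) ^ 2 + 1 + 1 ≤ 2 ^ b ∧
      (b : ℝ) ≤ 10 * ((r : ℝ) * (n : ℝ) * Real.log (n : ℝ) + Real.log (D : ℝ)) := by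
  set X := D * (n ^ n * 2 ^ n) ^ r with hX
  -- `max D 1` has the same logarithm as `D`, also for `D = 0`.
  set Y := max D 1 * (n ^ n * 2 ^ n) ^ r with hY
  have hXY : X ≤ Y := Nat.mul_le_mul_right _ (le_max_left _ _)
  have hY1 : 1 ≤ Y := Nat.one_le_iff_ne_zero.mpr (by positivity)
  have hlogD : Real.log ((max D 1 : ℕ) : ℝ) = Real.log D := by
    rcases Nat.eq_zero_or_pos D with rfl | hD
    · simp
    · rw [max_eq_left hD]
  have hlogY : Real.log (Y : ℝ) =
      Real.log D + r * (n * Real.log n + n * Real.log 2) := by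
    have hn0 : (n : ℝ) ≠ 0 := by positivity
    have hm0 : ((max D 1 : ℕ) : ℝ) ≠ 0 := by positivity
    rw [hY, Nat.cast_mul, Real.log_mul hm0 (by positivity), hlogD]
    push_cast
    rw [Real.log_pow, Real.log_mul (by positivity) (by positivity), Real.log_pow, Real.log_pow]
  refine ⟨Nat.clog 2 (X ^ 2 + 1 + 1), Nat.le_pow_clog one_lt_two _, ?_⟩
  set b := Nat.clog 2 (X ^ 2 + 1 + 1) with hb
  have hb1 : 2 ^ (b - 1) ≤ 3 * Y ^ 2 := by
    have h1 : 2 ^ b.pred < X ^ 2 + 1 + 1 := Nat.pow_pred_clog_lt_self one_lt_two (by omega)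
    have h2 : X ^ 2 ≤ Y ^ 2 := Nat.pow_le_pow_left hXY 2
    have h3 : 1 ≤ Y ^ 2 := Nat.one_le_pow _ _ hY1
    rw [Nat.pred_eq_sub_one] at h1
    omega
  have hlog : ((b - 1 : ℕ) : ℝ) * Real.log 2 ≤ Real.log 3 + 2 * Real.log Y := by
    have hYpos : (0 : ℝ) < Y := by exact_mod_cast hY1
    have h := Real.log_le_log (by positivity) (show ((2 : ℝ) ^ (b - 1)) ≤ 3 * (Y : ℝ) ^ 2 by
      exact_mod_cast hb1)
    rw [Real.log_pow, Real.log_mul (by norm_num) (by positivity), Real.log_pow] at h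
    exact_mod_cast h
  have hbsub : (b : ℝ) ≤ ((b - 1 : ℕ) : ℝ) + 1 := by exact_mod_cast (by omega : b ≤ b - 1 + 1)
  have hn3 : (3 : ℝ) ≤ n := by exact_mod_cast hn
  have hr1 : (1 : ℝ) ≤ r := by exact_mod_cast hr
  have h2n : Real.log 2 ≤ Real.log n := Real.log_le_log (by norm_num) (by linarith)
  have h3n : Real.log 3 ≤ Real.log n := Real.log_le_log (by norm_num) hn3
  have hl2 : (0.69 : ℝ) < Real.log 2 := by linarith [Real.log_two_gt_d9]
  have hD0 : 0 ≤ Real.log (D : ℝ) := Real.log_natCast_nonneg D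
  have hrn : (3 : ℝ) ≤ r * n := by nlinarith
  set L : ℝ := r * n * Real.log n with hL
  have hL3 : 3 * Real.log n ≤ L := mul_le_mul_of_nonneg_right hrn (by linarith)
  have hL2 : r * n * Real.log 2 ≤ L := mul_le_mul_of_nonneg_left h2n (by linarith)
  have hmain : ((b - 1 : ℕ) : ℝ) * Real.log 2 ≤ 5 * L + 2 * Real.log D := by
    rw [hlogY] at hlog
    have : (r : ℝ) * (n * Real.log n + n * Real.log 2) = L + r * n * Real.log 2 := by ring
    linarith
  have hb0 : (0 : ℝ) ≤ ((b - 1 : ℕ) : ℝ) := Nat.cast_nonneg _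
  have h69 : ((b - 1 : ℕ) : ℝ) * 0.69 ≤ ((b - 1 : ℕ) : ℝ) * Real.log 2 :=
    mul_le_mul_of_nonneg_left hl2.le hb0
  linarith

/-! ### Bounded encodings of the full-information protocol -/

theorem mainTheorem2 :
    ∃ C : ℝ, 0 < C ∧
      ∀ (n : ℕ), 2 < n →
      ∀ (V : Type u) (I : ChromaticComplex n V) (D : ℕ),
        (∀ x : V, {σ | σ ∈ I.faces ∧ x ∈ σ}.encard ≤ (D : ℕ∞)) →
      ∀ (r : ℕ), 1 ≤ r →
        ∃ (P : IteratedProtocol.{u, u, 0} n V) (b : ℕ),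
          P.FitsInBits r b ∧
          (b : ℝ) ≤ C * ((r : ℝ) * (n : ℝ) * Real.log (n : ℝ) + Real.log (D : ℝ)) ∧
          ((fullInformation n V).protocolComplex r I).Isomorphic (P.protocolComplex r I) := by
  refine ⟨10, by norm_num, fun n hn V I D hD r hr => ?_⟩
  have hdeg := (ChromaticComplex.faceDegreeLE_of_encard_le hD).complexAux
  choose c hc hsep using fun k => (hdeg k).exists_locallySeparating
  obtain ⟨b, hb, hbound⟩ := exists_bit_bound hn D hr
  refine ⟨compressedProtocol (fun k => ((fullInformation n V).complexAux I k).1) c, b,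
    IteratedProtocol.fitsInBits_compressed _ (fun k hk x => (hc k x).trans_le ?_) hb, hbound, ?_⟩
  · gcongr
    exact Nat.one_le_iff_ne_zero.mpr (by positivity)
  · have heq : (compressedProtocol (fun k => ((fullInformation n V).complexAux I k).1)
        c).protocolComplex r I = (fullInformation n V).protocolComplex r I :=
      congrArg Subtype.val (IteratedProtocol.complexAux_compressed I hsep r)
    exact heq ▸ ChromaticComplex.Isomorphic.refl _
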